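/- Let $d\ge 1$ be an integer and let $0<\eta<1$, $1\le p<\infty$ with $\eta p<1$. For $f:\mathbb{R}^d\to\mathbb{C}$ let $$\|f\|_{W^{\eta,p}}:=\left(\int_{\mathbb{R}^d}\int_{\mathbb{R}^d}\frac{|f(x)-f(y)|^p}{|x-y|^{d+\eta p}}\,dx\,dy\right)^{1/p}$$ be the Gagliardo–Slobodeckij semi-norm, and let $W^{\eta,p}(\mathbb{R}^d)$ be the space of all $f\in L^p(\mathbb{R}^d)$ with $\|f\|_{W^{\eta,p}}<\infty$. For $1\le q<\infty$ and measurable $g$ on $\mathbb{R}^d$ let $\|g\|_{L^{q,\infty}}:=\sup_{t>0}t\,|\{x\in\mathbb{R}^d:|g(x)|>t\}|^{1/q}$. Then there is a positive constant $C=C(\eta,p,d)$ such that for every set $E\subset\mathbb{R}^d$ whose characteristic function $\chi_E$ belongs to $W^{\eta,p}(\mathbb{R}^d)$ (in particular $|E|<\infty$, so $\chi_E\in L^1(\mathbb{R}^d)$), $$\|\widehat{\chi_E}\|_{L^{\frac{2d}{d+\eta p},\infty}}\le C\,\|\chi_E\|_{W^{\eta,p}}^{p/2},$$ where $\widehat{\chi_E}(\xi)=\int_E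 e^{-2\pi i x\cdot\xi}\,dx$. -/

import Mathlib

open MeasureTheory
open scoped ENNReal NNReal FourierTransform

noncomputable section

/-- The Gagliardo--Slobodeckij semi-norm
`‖f‖_{W^{η,p}} = (∫∫ |f x - f y| ^ p / |x - y| ^ (d + η p) dy dx) ^ (1 / p)` of a function on `ℝ^d`,
with values in `[0, ∞]`. On the diagonal the integrand is `0 / 0 = 0` for `p > 0`. -/
def gagliardoSeminorm {d : ℕ} (η p : ℝ) (f : EuclideanSpace ℝ (Fin d) → ℂ) : ℝ≥0∞ :=
  (∫⁻ x, ∫⁻ y, ‖f x - f y‖ₑ ^ p / ‖x - y‖ₑ ^ ((d : ℝ) + η * p)) ^ (1 / p)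

/-- Membership in the fractional Sobolev space `W^{η,p}(ℝ^d)`: the function is in `L^p(ℝ^d)`
and its Gagliardo--Slobodeckij semi-norm is finite. -/
def MemSobolevSlobodeckij {d : ℕ} (η p : ℝ) (f : EuclideanSpace ℝ (Fin d) → ℂ) : Prop :=
  MemLp f (ENNReal.ofReal p) ∧ gagliardoSeminorm η p f < ∞

/-- The weak Lebesgue (Lorentz `L^{q,∞}`) quasi-norm `sup_{t > 0} t |{x : |f x| > t}| ^ (1 / q)`
of a function on `ℝ^d`, with values in `[0, ∞]`. -/
def weakLpNorm {d : ℕ} (q : ℝ) (f : EuclideanSpace ℝ (Fin d) → ℂ) : ℝ≥0∞ :=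
  ⨆ (t : ℝ≥0) (_ : 0 < t), (t : ℝ≥0∞) * volume {x | (t : ℝ≥0∞) < ‖f x‖ₑ} ^ (1 / q)

/-- The characteristic function `χ_E`, as a complex-valued function. -/
def charFn {d : ℕ} (E : Set (EuclideanSpace ℝ (Fin d))) : EuclideanSpace ℝ (Fin d) → ℂ :=
  E.indicator (fun _ => 1)

end

/-! Differences of a characteristic function have modulus 0 or 1, so replacing the exponent `p` by 2
leaves the integrand unchanged. With `b = ηp`, `‖χ_E‖ ^ p` is therefore a quadratic energy with
kernel `|x - y| ^ (-(d + b))`. Plancherel applied to each translation difference bounds it below by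
a multiple of `I = ∫ |ξ| ^ b |𝓕 χ_E| ^ 2` (`lintegral_rpow_mul_enorm_fourier_sq_le`).

A weighted `L²` bound gives a weak-type bound: Chebyshev handles `|ξ| ≥ R`, the volume of the ball
handles `|ξ| < R`, and balancing the two in `R` gives the exponent `2d / (d + b)`
(`mul_measure_lt_enorm_rpow_le`). -/

/-! ### Plancherel and the quadratic Gagliardo energy -/

section Plancherel

variable {V : Type*} [NormedAddCommGroup V] [InnerProductSpace ℝ V] [FiniteDimensional ℝ V]
  [MeasurableSpace V] [BorelSpace V]

/-- The `L²` Fourier transform of a function in `L¹ ∩ L²` is given by the Fourier integral. -/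
theorem MeasureTheory.MemLp.coeFn_fourier_toLp {f : V → ℂ} (hf : Integrable f) (hf₂ : MemLp f 2) :
    ((𝓕 (hf₂.toLp f) : Lp ℂ 2 (volume : Measure V)) : V → ℂ) =ᵐ[volume] 𝓕 f := by
  have hcont : Continuous (𝓕 f) :=
    VectorFourier.fourierIntegral_continuous Real.continuous_fourierChar
      (innerSL ℝ).continuous₂ hf
  refine ae_eq_of_integral_contDiff_smul_eq
    ((Lp.memLp _).locallyIntegrable (by norm_num)) hcont.locallyIntegrable ?_
  intro g hg hgc
  have hg₁ : HasCompactSupport (Complex.ofRealCLM ∘ g) := hgc.comp_left rfl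
  have hg₂ : ContDiff ℝ (⊤ : ℕ∞) (Complex.ofRealCLM ∘ g) := by fun_prop
  set φ : SchwartzMap V ℂ := hg₁.toSchwartzMap hg₂ with hφ
  have hφg (x : V) : φ x = (g x : ℂ) := rfl
  -- The `L²` transform agrees with the distributional one, so testing against `φ` moves the
  -- transform onto `φ`; the flip identity then moves it back onto the integrable `f`.
  have h := congrArg (fun T : TemperedDistribution V ℂ => T φ)
    (Lp.fourier_toTemperedDistribution_eq (hf₂.toLp f))
  simp only [TemperedDistribution.fourier_apply, Lp.toTemperedDistribution_apply] at h
  have h₁ : ∫ x, g x • (𝓕 (hf₂.toLp f) : Lp ℂ 2 (volume : Measure V)) x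
      = ∫ x, φ x • (𝓕 (hf₂.toLp f) : Lp ℂ 2 (volume : Measure V)) x := by
    simp [hφg]
  have h₂ : ∫ x, 𝓕 φ x • (hf₂.toLp f) x = ∫ x, 𝓕 (φ : V → ℂ) x • f x := by
    refine integral_congr_ae ?_
    filter_upwards [hf₂.coeFn_toLp] with x hx
    rw [hx, SchwartzMap.fourier_coe]
  have h₃ : ∫ x, 𝓕 (φ : V → ℂ) x • f x = ∫ x, φ x • 𝓕 f x := by
    simpa using! VectorFourier.integral_fourierIntegral_smul_eq_flip (L := innerₗ V)
      Real.continuous_fourierChar continuous_inner φ.integrable hf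
  rw [h₁, ← h, h₂, h₃]
  simp [hφg]

/-- Plancherel's theorem for functions in `L¹ ∩ L²`. -/
theorem lintegral_enorm_fourier_sq {f : V → ℂ} (hf : Integrable f) (hf₂ : MemLp f 2) :
    ∫⁻ ξ, ‖𝓕 f ξ‖ₑ ^ 2 = ∫⁻ x, ‖f x‖ₑ ^ 2 := by
  have key : eLpNorm (𝓕 f) 2 volume = eLpNorm f 2 volume := by
    rw [← eLpNorm_congr_ae (MemLp.coeFn_fourier_toLp hf hf₂), ← eLpNorm_congr_ae hf₂.coeFn_toLp,
      ← Lp.enorm_def, ← Lp.enorm_def, ← ofReal_norm, ← ofReal_norm, Lp.norm_fourier_eq]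
  have h (g : V → ℂ) : ∫⁻ x, ‖g x‖ₑ ^ 2 = eLpNorm g 2 volume ^ 2 := by
    rw [eLpNorm_eq_lintegral_rpow_enorm_toReal (by norm_num) (by norm_num), ← ENNReal.rpow_natCast,
      ← ENNReal.rpow_mul]
    simp
  rw [h, h, key]

theorem lintegral_enorm_translate_sub_sq {f : V → ℂ} (hf : Integrable f) (hf₂ : MemLp f 2)
    (h : V) :
    ∫⁻ x, ‖f x - f (x + h)‖ₑ ^ 2 =
      ∫⁻ ξ, ‖(Real.fourierChar (inner ℝ h ξ) : ℂ) - 1‖ₑ ^ 2 * ‖𝓕 f ξ‖ₑ ^ 2 := by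
  have hi : Integrable (fun x => f (x + h)) := hf.comp_add_right h
  have hi₂ : MemLp (fun x => f (x + h)) 2 :=
    hf₂.comp_measurePreserving (measurePreserving_add_right volume h)
  have := lintegral_enorm_fourier_sq (hi.sub hf) (hi₂.sub hf₂)
  simp only [Pi.sub_apply] at this
  rw [lintegral_congr fun x => by rw [← enorm_neg, neg_sub], ← this]
  refine lintegral_congr fun ξ => ?_
  have h₁ : 𝓕 ((fun x => f (x + h)) - f) ξ = 𝓕 (fun x => f (x + h)) ξ - 𝓕 f ξ := by
    have hc (g : V → ℂ) (hg : Integrable g) := (Real.fourierIntegral_convergent_iff ξ).2 hg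
    simp only [Real.fourier_eq, Pi.sub_apply, smul_sub]
    exact integral_sub (hc _ hi) (hc _ hf)
  have h₂ : 𝓕 (fun x => f (x + h)) ξ = (Real.fourierChar (inner ℝ h ξ) : ℂ) * 𝓕 f ξ :=
    congrFun (VectorFourier.fourierIntegral_comp_add_right Real.fourierChar volume
      (innerₗ V) f h) ξ
  rw [h₁, h₂, ← mul_pow, ← enorm_mul, sub_mul, one_mul]

/-- Substitute `y = x + h`, apply Plancherel in `x` for each fixed `h`, and use Tonelli before and
after. -/
theorem lintegral_lintegral_enorm_sub_sq_div {f : V → ℂ} (hfm : Measurable f) (hf : Integrable f)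
    (hf₂ : MemLp f 2) (a : ℝ) :
    ∫⁻ x, ∫⁻ y, ‖f x - f y‖ₑ ^ 2 / ‖x - y‖ₑ ^ a =
      ∫⁻ ξ, (∫⁻ h, ‖(Real.fourierChar (inner ℝ h ξ) : ℂ) - 1‖ₑ ^ 2 / ‖h‖ₑ ^ a) *
        ‖𝓕 f ξ‖ₑ ^ 2 := by
  have hcont : Continuous (𝓕 f) :=
    VectorFourier.fourierIntegral_continuous Real.continuous_fourierChar
      (innerSL ℝ).continuous₂ hf
  have hm₁ : Measurable (fun z : V × V => ‖f z.1 - f (z.1 + z.2)‖ₑ ^ 2 / ‖z.2‖ₑ ^ a) := by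
    fun_prop
  have hc : Continuous (fun z : V × V => (Real.fourierChar (inner ℝ z.1 z.2) : ℂ)) :=
    continuous_subtype_val.comp (Real.continuous_fourierChar.comp continuous_inner)
  have hm₂ : Measurable (fun z : V × V => ‖(Real.fourierChar (inner ℝ z.1 z.2) : ℂ) - 1‖ₑ ^ 2 *
      ‖𝓕 f z.2‖ₑ ^ 2 / ‖z.1‖ₑ ^ a) := by
    have := hc.measurable
    have := hcont.measurable
    fun_prop
  calc
    _ = ∫⁻ x, ∫⁻ h, ‖f x - f (x + h)‖ₑ ^ 2 / ‖h‖ₑ ^ a := by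
      refine lintegral_congr fun x => ?_
      rw [← lintegral_add_left_eq_self _ x]
      refine lintegral_congr fun h => ?_
      rw [sub_add_cancel_left, enorm_neg]
    _ = ∫⁻ h, ∫⁻ x, ‖f x - f (x + h)‖ₑ ^ 2 / ‖h‖ₑ ^ a := lintegral_lintegral_swap hm₁.aemeasurable
    _ = ∫⁻ h, ∫⁻ ξ, ‖(Real.fourierChar (inner ℝ h ξ) : ℂ) - 1‖ₑ ^ 2 * ‖𝓕 f ξ‖ₑ ^ 2 / ‖h‖ₑ ^ a := by
      refine lintegral_congr fun h => ?_
      simp only [div_eq_mul_inv]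
      rw [lintegral_mul_const, lintegral_mul_const, lintegral_enorm_translate_sub_sq hf hf₂]
      · have := (hc.comp (Continuous.prodMk_right h)).measurable
        have := hcont.measurable
        simp only [Function.comp_def] at *
        fun_prop
      · fun_prop
    _ = ∫⁻ ξ, ∫⁻ h, ‖(Real.fourierChar (inner ℝ h ξ) : ℂ) - 1‖ₑ ^ 2 * ‖𝓕 f ξ‖ₑ ^ 2 / ‖h‖ₑ ^ a :=
      lintegral_lintegral_swap hm₂.aemeasurable
    _ = _ := by
      refine lintegral_congr fun ξ => ?_
      simp only [div_eq_mul_inv, mul_right_comm _ (‖𝓕 f ξ‖ₑ ^ 2)]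
      rw [lintegral_mul_const]
      have := (hc.comp (Continuous.prodMk_left ξ)).measurable
      simp only [Function.comp_def] at this
      fun_prop

theorem one_le_norm_fourierChar_sub_one {θ : ℝ} (h₁ : 1 / 4 ≤ θ) (h₂ : θ ≤ 3 / 4) :
    1 ≤ ‖(Real.fourierChar θ : ℂ) - 1‖ := by
  have hcos : Real.cos (2 * Real.pi * θ) ≤ 0 :=
    Real.cos_nonpos_of_pi_div_two_le_of_le (by nlinarith [Real.pi_pos])
      (by nlinarith [Real.pi_pos])
  have hre : ((Real.fourierChar θ : ℂ) - 1).re = Real.cos (2 * Real.pi * θ) - 1 := by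
    rw [Real.fourierChar_apply, Complex.sub_re, Complex.exp_ofReal_mul_I_re,
      Complex.one_re]
  have := Complex.abs_re_le_norm ((Real.fourierChar θ : ℂ) - 1)
  rw [hre, abs_of_nonpos (by linarith)] at this
  linarith

/-- By scaling, it suffices to integrate over one ball of radius comparable to `1 / ‖ξ‖` on which
the phase stays away from the integers. -/
theorem le_lintegral_enorm_fourierChar_sub_one_sq_div {b : ℝ} (hb : 0 < b) (ξ : V) :
    volume (Metric.ball (0 : V) 1) * ENNReal.ofReal ((1 / 4) ^ Module.finrank ℝ V) * ‖ξ‖ₑ ^ b ≤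
      ∫⁻ h, ‖(Real.fourierChar (inner ℝ h ξ) : ℂ) - 1‖ₑ ^ 2 /
        ‖h‖ₑ ^ (Module.finrank ℝ V + b) := by
  rcases eq_or_ne ξ 0 with rfl | hξ
  · simp [ENNReal.zero_rpow_of_pos hb]
  have hr : 0 < ‖ξ‖ := norm_pos_iff.2 hξ
  set d := Module.finrank ℝ V
  set r := ‖ξ‖ with hr_def
  -- The centre has phase `1 / 2`; radius `1 / (4 * r)` keeps the phase in `[1/4, 3/4]` and `‖h‖ ≤ 1
  -- / r`.
  set c : V := (1 / (2 * r ^ 2)) • ξ with hc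
  have hcn : ‖c‖ = 1 / (2 * r) := by
    rw [hc, norm_smul, Real.norm_of_nonneg (by positivity), ← hr_def]
    field_simp
  have hci : inner ℝ c ξ = 1 / 2 := by
    rw [hc, real_inner_smul_left, real_inner_self_eq_norm_sq, ← hr_def]
    field_simp
  have hpt : ∀ h ∈ Metric.ball c (1 / (4 * r)), ENNReal.ofReal (r ^ (d + b)) ≤
      ‖(Real.fourierChar (inner ℝ h ξ) : ℂ) - 1‖ₑ ^ 2 / ‖h‖ₑ ^ (d + b) := by
    intro h hh
    rw [mem_ball_iff_norm] at hh
    have hi : |inner ℝ h ξ - 1 / 2| ≤ 1 / 4 := by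
      rw [← hci, ← inner_sub_left]
      calc
        _ ≤ ‖h - c‖ * ‖ξ‖ := abs_real_inner_le_norm _ _
        _ ≤ 1 / (4 * r) * r := by gcongr
        _ = 1 / 4 := by field_simp
    have hn : ‖h‖ ≤ r⁻¹ := by
      calc
        _ ≤ ‖c‖ + ‖h - c‖ := norm_le_norm_add_norm_sub' _ _
        _ ≤ 1 / (2 * r) + 1 / (4 * r) := by rw [hcn]; gcongr
        _ = 3 / 4 * r⁻¹ := by field_simp; norm_num
        _ ≤ r⁻¹ := by nlinarith [inv_pos.2 hr]
    have hone := one_le_norm_fourierChar_sub_one (θ := inner ℝ h ξ)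
      (by linarith [abs_le.1 hi]) (by linarith [abs_le.1 hi])
    have hone' : 1 ≤ ‖(Real.fourierChar (inner ℝ h ξ) : ℂ) - 1‖ₑ := by
      rw [← ofReal_norm]
      exact ENNReal.one_le_ofReal.2 hone
    have hab : (0 : ℝ) ≤ d + b := by positivity
    calc
      ENNReal.ofReal (r ^ (d + b)) = 1 / ENNReal.ofReal (r⁻¹) ^ (d + b) := by
        rw [ENNReal.ofReal_inv_of_pos hr, ENNReal.inv_rpow, one_div, inv_inv,
          ENNReal.ofReal_rpow_of_pos hr]
      _ ≤ _ := by
        refine ENNReal.div_le_div (one_le_pow₀ hone') (ENNReal.rpow_le_rpow ?_ hab)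
        rw [← ofReal_norm]
        exact ENNReal.ofReal_le_ofReal hn
  calc
    _ = ENNReal.ofReal (r ^ (d + b)) * volume (Metric.ball c (1 / (4 * r))) := by
      rw [Measure.addHaar_ball_of_pos volume c (r := 1 / (4 * r)) (by positivity), ← mul_assoc,
        ← ENNReal.ofReal_mul (by positivity), ← ofReal_norm, ← hr_def,
        ENNReal.ofReal_rpow_of_pos hr, mul_assoc, ← ENNReal.ofReal_mul (by positivity), mul_comm]
      congr 2
      have hd : r ^ d * (1 / (4 * r)) ^ d = (1 / 4) ^ d := by
        rw [← mul_pow]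
        congr 1
        field_simp
      rw [Real.rpow_add hr, Real.rpow_natCast, ← hd]
      ring
    _ = ∫⁻ _ in Metric.ball c (1 / (4 * r)), ENNReal.ofReal (r ^ (d + b)) := by simp
    _ ≤ ∫⁻ h in Metric.ball c (1 / (4 * r)), _ := setLIntegral_mono' measurableSet_ball hpt
    _ ≤ _ := setLIntegral_le_lintegral _ _

/-- The Gagliardo energy with exponent `2` controls the weighted `L²` norm of the Fourier
transform. -/
theorem lintegral_rpow_mul_enorm_fourier_sq_le {f : V → ℂ} (hfm : Measurable f)
    (hf : Integrable f) (hf₂ : MemLp f 2) {b : ℝ} (hb : 0 < b) :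
    volume (Metric.ball (0 : V) 1) * ENNReal.ofReal ((1 / 4) ^ Module.finrank ℝ V) *
        ∫⁻ ξ, ‖ξ‖ₑ ^ b * ‖𝓕 f ξ‖ₑ ^ 2 ≤
      ∫⁻ x, ∫⁻ y, ‖f x - f y‖ₑ ^ 2 / ‖x - y‖ₑ ^ (Module.finrank ℝ V + b) := by
  rw [lintegral_lintegral_enorm_sub_sq_div hfm hf hf₂, ← lintegral_const_mul']
  · refine lintegral_mono fun ξ => ?_
    rw [← mul_assoc]
    gcongr
    exact le_lintegral_enorm_fourierChar_sub_one_sq_div hb ξ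
  · exact ENNReal.mul_ne_top measure_ball_lt_top.ne ENNReal.ofReal_ne_top

end Plancherel

/-! ### From a weighted `L²` bound to a weak-type bound -/

section WeakType

variable {V : Type*} [NormedAddCommGroup V] [NormedSpace ℝ V] [FiniteDimensional ℝ V]
  [MeasurableSpace V] [BorelSpace V] (μ : Measure V) [μ.IsAddHaarMeasure]

theorem measure_lt_enorm_le_ball_add {g : V → ℂ} (hg : Measurable g) {b R : ℝ} (hb : 0 ≤ b)
    (hR : 0 < R) {t : ℝ≥0} (ht : 0 < t) :
    μ {x | (t : ℝ≥0∞) < ‖g x‖ₑ} ≤ ENNReal.ofReal (R ^ Module.finrank ℝ V) * μ (Metric.ball 0 1) +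
      (∫⁻ x, ‖x‖ₑ ^ b * ‖g x‖ₑ ^ 2 ∂μ) / ENNReal.ofReal (R ^ b * t ^ 2) := by
  have hsub : {x | (t : ℝ≥0∞) < ‖g x‖ₑ} ⊆ Metric.ball 0 R ∪
      {x | ENNReal.ofReal (R ^ b * t ^ 2) ≤ ‖x‖ₑ ^ b * ‖g x‖ₑ ^ 2} := by
    intro x hx
    by_cases hxR : ‖x‖ < R
    · exact Or.inl (by simpa using hxR)
    · refine Or.inr ?_
      have hxR' : ENNReal.ofReal R ≤ ‖x‖ₑ := by
        rw [← ofReal_norm]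
        exact ENNReal.ofReal_le_ofReal (not_lt.1 hxR)
      rw [Set.mem_ofPred_eq, ENNReal.ofReal_mul (by positivity), ← ENNReal.ofReal_rpow_of_pos hR,
        ENNReal.ofReal_pow (by positivity), ENNReal.ofReal_coe_nnreal]
      gcongr
      exact le_of_lt hx
  refine (measure_mono hsub).trans ((measure_union_le _ _).trans ?_)
  rw [Measure.addHaar_ball_of_pos μ _ hR]
  gcongr
  refine meas_ge_le_lintegral_div (by fun_prop) ?_ ENNReal.ofReal_ne_top
  exact (ENNReal.ofReal_pos.2 (by positivity)).ne'

theorem mul_measure_lt_enorm_rpow_le {g : V → ℂ} (hg : Measurable g) {b : ℝ} (hb : 0 < b)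
    (hd : 0 < Module.finrank ℝ V) {t : ℝ≥0} (ht : 0 < t)
    (hI : ∫⁻ x, ‖x‖ₑ ^ b * ‖g x‖ₑ ^ 2 ∂μ ≠ ∞) :
    t * μ {x | (t : ℝ≥0∞) < ‖g x‖ₑ} ^ ((Module.finrank ℝ V + b) / (2 * Module.finrank ℝ V)) ≤
      (μ (Metric.ball 0 1) + 1) ^ ((Module.finrank ℝ V + b) / (2 * Module.finrank ℝ V)) *
        (∫⁻ x, ‖x‖ₑ ^ b * ‖g x‖ₑ ^ 2 ∂μ) ^ (1 / 2 : ℝ) := by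
  set d := Module.finrank ℝ V
  set I := ∫⁻ x, ‖x‖ₑ ^ b * ‖g x‖ₑ ^ 2 ∂μ with hI_def
  set K := μ (Metric.ball (0 : V) 1) with hK_def
  set e : ℝ := (d + b) / (2 * d) with he
  have hd' : (0 : ℝ) < d := Nat.cast_pos.2 hd
  have he₀ : 0 ≤ e := by positivity
  have ht' : (0 : ℝ) < t := ht
  have hKe : (K + 1) ^ e ≠ ∞ :=
    ENNReal.rpow_ne_top_of_nonneg he₀ (ENNReal.add_ne_top.2 ⟨measure_ball_lt_top.ne, by simp⟩)
  -- A positive majorant `a` replaces `I`, which may vanish, so that the radius below is positive;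
  -- `a` decreases to `I` at the end.
  have main : ∀ a : ℝ, 0 < a → I ≤ ENNReal.ofReal a →
      t * μ {x | (t : ℝ≥0∞) < ‖g x‖ₑ} ^ e ≤ (K + 1) ^ e * ENNReal.ofReal a ^ (1 / 2 : ℝ) := by
    intro a ha hIa
    -- This radius balances the two terms: `R ^ d = a / (R ^ b * t ^ 2)`.
    set R : ℝ := (a / t ^ 2) ^ (1 / (d + b)) with hR_def
    have hR : 0 < R := by positivity
    have hRdb : R ^ (d : ℝ) * R ^ b = a / t ^ 2 := by
      rw [← Real.rpow_add hR, hR_def, ← Real.rpow_mul (by positivity),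
        one_div_mul_cancel (by positivity), Real.rpow_one]
    have hS : μ {x | (t : ℝ≥0∞) < ‖g x‖ₑ} ≤ (K + 1) * ENNReal.ofReal (R ^ (d : ℝ)) := by
      refine (measure_lt_enorm_le_ball_add μ hg hb.le hR ht).trans ?_
      rw [add_mul, one_mul, mul_comm K, Real.rpow_natCast]
      gcongr
      refine (ENNReal.div_le_div_right hIa _).trans ?_
      rw [← ENNReal.ofReal_div_of_pos (by positivity)]
      refine (congrArg ENNReal.ofReal ?_).le
      rw [← Real.rpow_natCast R, div_eq_iff (by positivity), ← mul_assoc, hRdb]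
      field_simp
    calc
      _ ≤ t * ((K + 1) * ENNReal.ofReal (R ^ (d : ℝ))) ^ e := by gcongr
      _ = (K + 1) ^ e * (t * ENNReal.ofReal (R ^ (d : ℝ)) ^ e) := by
        rw [ENNReal.mul_rpow_of_nonneg _ _ he₀]
        ring
      _ = _ := by
        congr 1
        rw [← ENNReal.ofReal_coe_nnreal, ENNReal.ofReal_rpow_of_pos (by positivity),
          ENNReal.ofReal_rpow_of_pos ha, ← ENNReal.ofReal_mul (by positivity)]
        congr 1
        rw [← Real.rpow_mul hR.le, hR_def, ← Real.rpow_mul (by positivity),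
          show 1 / (d + b) * (d * e) = 1 / 2 by rw [he]; field_simp,
          Real.div_rpow ha.le (by positivity), ← Real.sqrt_eq_rpow, ← Real.sqrt_eq_rpow,
          Real.sqrt_sq ht'.le]
        field_simp
  have hlim : Filter.Tendsto
      (fun ε : ℝ => (K + 1) ^ e * ENNReal.ofReal (I.toReal + ε) ^ (1 / 2 : ℝ))
      (nhdsWithin 0 (Set.Ioi 0)) (nhds ((K + 1) ^ e * I ^ (1 / 2 : ℝ))) := by
    refine ENNReal.Tendsto.const_mul ?_ (Or.inr hKe)
    have hc : Continuous (fun ε : ℝ => ENNReal.ofReal (I.toReal + ε) ^ (1 / 2 : ℝ)) :=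
      ENNReal.continuous_rpow_const.comp (ENNReal.continuous_ofReal.comp (by fun_prop))
    have := (hc.tendsto 0).mono_left (nhdsWithin_le_nhds (s := Set.Ioi 0))
    simpa [ENNReal.ofReal_toReal hI] using this
  refine ge_of_tendsto hlim ?_
  filter_upwards [self_mem_nhdsWithin] with ε hε
  refine main _ (add_pos_of_nonneg_of_pos ENNReal.toReal_nonneg hε) ?_
  rw [← ENNReal.ofReal_toReal hI]
  refine ENNReal.ofReal_le_ofReal ?_
  rw [ENNReal.toReal_ofReal ENNReal.toReal_nonneg]
  linarith [Set.mem_Ioi.1 hε]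

end WeakType

/-! ### Characteristic functions -/

section CharFn

variable {d : ℕ}

theorem enorm_charFn_sub_charFn_rpow (E : Set (EuclideanSpace ℝ (Fin d))) {p : ℝ} (hp : 0 < p)
    (x y : EuclideanSpace ℝ (Fin d)) :
    ‖charFn E x - charFn E y‖ₑ ^ p = ‖charFn E x - charFn E y‖ₑ ^ 2 := by
  by_cases hx : x ∈ E <;> by_cases hy : y ∈ E <;> simp [charFn, hx, hy, hp]

theorem gagliardoSeminorm_charFn_rpow (E : Set (EuclideanSpace ℝ (Fin d))) (η : ℝ) {p : ℝ}
    (hp : 0 < p) :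
    gagliardoSeminorm η p (charFn E) ^ (p / 2) =
      (∫⁻ x, ∫⁻ y, ‖charFn E x - charFn E y‖ₑ ^ 2 / ‖x - y‖ₑ ^ ((d : ℝ) + η * p)) ^
        (1 / 2 : ℝ) := by
  simp only [gagliardoSeminorm, enorm_charFn_sub_charFn_rpow E hp]
  rw [← ENNReal.rpow_mul]
  congr 1
  field_simp

theorem charFn_ae_eq {E F : Set (EuclideanSpace ℝ (Fin d))} (h : E =ᵐ[volume] F) :
    charFn E =ᵐ[volume] charFn F :=
  indicator_ae_eq_of_ae_eq_set h

theorem gagliardoSeminorm_congr_ae {η p : ℝ} {f g : EuclideanSpace ℝ (Fin d) → ℂ}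
    (h : f =ᵐ[volume] g) : gagliardoSeminorm η p f = gagliardoSeminorm η p g := by
  unfold gagliardoSeminorm
  congr 1
  refine lintegral_congr_ae ?_
  filter_upwards [h] with x hx
  refine lintegral_congr_ae ?_
  filter_upwards [h] with y hy
  rw [hx, hy]

theorem nullMeasurableSet_of_memLp_charFn {E : Set (EuclideanSpace ℝ (Fin d))} {p : ℝ≥0∞}
    (h : MemLp (charFn E) p) : NullMeasurableSet E :=
  (aemeasurable_indicator_const_iff (1 : ℂ)).1 h.aestronglyMeasurable.aemeasurable

theorem measure_ne_top_of_memLp_charFn {E : Set (EuclideanSpace ℝ (Fin d))} {p : ℝ≥0∞}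
    (hp₀ : p ≠ 0) (hp : p ≠ ∞) (h : MemLp (charFn E) p) : volume E ≠ ∞ := by
  have h₁ := h.eLpNorm_lt_top
  rw [charFn, eLpNorm_indicator_const₀ (nullMeasurableSet_of_memLp_charFn h) hp₀ hp] at h₁
  intro hE
  have : 0 < p.toReal := ENNReal.toReal_pos hp₀ hp
  simp [hE, this] at h₁

theorem weakLpNorm_fourier_charFn_le (hd : 1 ≤ d) {b : ℝ} (hb : 0 < b)
    {E : Set (EuclideanSpace ℝ (Fin d))} (hE : MeasurableSet E) (hE' : volume E ≠ ∞)
    (hG : ∫⁻ x, ∫⁻ y, ‖charFn E x - charFn E y‖ₑ ^ 2 / ‖x - y‖ₑ ^ ((d : ℝ) + b) ≠ ∞) :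
    weakLpNorm (2 * (d : ℝ) / (d + b)) (𝓕 (charFn E)) ≤
      (volume (Metric.ball (0 : EuclideanSpace ℝ (Fin d)) 1) + 1) ^ ((d + b) / (2 * d)) *
        ((volume (Metric.ball (0 : EuclideanSpace ℝ (Fin d)) 1) *
          ENNReal.ofReal ((1 / 4) ^ d))⁻¹ *
        ∫⁻ x, ∫⁻ y, ‖charFn E x - charFn E y‖ₑ ^ 2 / ‖x - y‖ₑ ^ ((d : ℝ) + b)) ^
          (1 / 2 : ℝ) := by
  have hfm : Measurable (charFn E) := measurable_const.indicator hE
  have hLp (q : ℝ≥0∞) : MemLp (charFn E) q := memLp_indicator_const q hE 1 (Or.inr hE')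
  have hf : Integrable (charFn E) := memLp_one_iff_integrable.1 (hLp 1)
  have hcont : Continuous (𝓕 (charFn E)) :=
    VectorFourier.fourierIntegral_continuous Real.continuous_fourierChar
      (innerSL ℝ).continuous₂ hf
  have hle := lintegral_rpow_mul_enorm_fourier_sq_le hfm hf (hLp 2) hb
  simp only [finrank_euclideanSpace, Fintype.card_fin] at hle
  set k := volume (Metric.ball (0 : EuclideanSpace ℝ (Fin d)) 1) * ENNReal.ofReal ((1 / 4) ^ d)
  have hk₀ : k ≠ 0 := mul_ne_zero (Metric.measure_ball_pos _ _ one_pos).ne'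
    (ENNReal.ofReal_pos.2 (by positivity)).ne'
  have hk : k ≠ ∞ := ENNReal.mul_ne_top measure_ball_lt_top.ne ENNReal.ofReal_ne_top
  rw [mul_comm, ← ENNReal.le_div_iff_mul_le (Or.inl hk₀) (Or.inl hk), div_eq_mul_inv,
    mul_comm] at hle
  have hI := ne_top_of_le_ne_top (ENNReal.mul_ne_top (ENNReal.inv_ne_top.2 hk₀) hG) hle
  refine iSup₂_le fun t ht => ?_
  have := mul_measure_lt_enorm_rpow_le volume hcont.measurable hb (by simpa using Nat.pos_of_ne_zero (by omega)) ht hI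
  simp only [finrank_euclideanSpace, Fintype.card_fin] at this
  rw [one_div_div]
  refine this.trans ?_
  gcongr

end CharFn

theorem corollary1p4 (d : ℕ) (hd : 1 ≤ d) (η p : ℝ) (hη₀ : 0 < η) (hη₁ : η < 1)
    (hp : 1 ≤ p) (hηp : η * p < 1) :
    ∃ C : ℝ≥0, 0 < C ∧ ∀ E : Set (EuclideanSpace ℝ (Fin d)),
      MemSobolevSlobodeckij η p (charFn E) →
        weakLpNorm (2 * (d : ℝ) / ((d : ℝ) + η * p)) (𝓕 (charFn E)) ≤
          (C : ℝ≥0∞) * gagliardoSeminorm η p (charFn E) ^ (p / 2) := by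
  have hp₀ : 0 < p := by linarith
  have hb : 0 < η * p := by positivity
  set K := volume (Metric.ball (0 : EuclideanSpace ℝ (Fin d)) 1)
  have hK : K ≠ ∞ := measure_ball_lt_top.ne
  have hK₀ : K ≠ 0 := (Metric.measure_ball_pos _ _ one_pos).ne'
  set k := K * ENNReal.ofReal ((1 / 4) ^ d)
  have hk₀ : k ≠ 0 := mul_ne_zero hK₀ (ENNReal.ofReal_pos.2 (by positivity)).ne'
  have hk : k ≠ ∞ := ENNReal.mul_ne_top hK ENNReal.ofReal_ne_top
  set C := (K + 1) ^ ((d + η * p) / (2 * d)) * k⁻¹ ^ (1 / 2 : ℝ)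
  have hC : C ≠ ∞ := ENNReal.mul_ne_top
    (ENNReal.rpow_ne_top_of_nonneg (by positivity) (ENNReal.add_ne_top.2 ⟨hK, by simp⟩))
    (ENNReal.rpow_ne_top_of_nonneg (by positivity) (ENNReal.inv_ne_top.2 hk₀))
  have hC₀ : C ≠ 0 := mul_ne_zero
    (ENNReal.rpow_pos (by positivity) (ENNReal.add_ne_top.2 ⟨hK, by simp⟩)).ne'
    (ENNReal.rpow_pos (ENNReal.inv_pos.2 hk) (ENNReal.inv_ne_top.2 hk₀)).ne'
  refine ⟨C.toNNReal, ENNReal.toNNReal_pos hC₀ hC, fun E ⟨hE, hG⟩ => ?_⟩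
  rw [ENNReal.coe_toNNReal hC]
  have hEn := nullMeasurableSet_of_memLp_charFn hE
  have hEF := hEn.toMeasurable_ae_eq
  have hEv := measure_ne_top_of_memLp_charFn (by simpa using hp₀) ENNReal.ofReal_ne_top hE
  -- `E` is only null-measurable; the seminorm and the Fourier integral do not see null sets, so a
  -- measurable hull may replace it.
  set F := toMeasurable volume E
  have hFou : 𝓕 (charFn E) = 𝓕 (charFn F) :=
    funext (Real.fourier_congr_ae (charFn_ae_eq hEF.symm))
  rw [gagliardoSeminorm_congr_ae (charFn_ae_eq hEF.symm)] at hG ⊢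
  rw [hFou]
  have hG' := ENNReal.rpow_ne_top_of_nonneg (y := p / 2) (by positivity) hG.ne
  rw [gagliardoSeminorm_charFn_rpow F η hp₀] at hG' ⊢
  refine (weakLpNorm_fourier_charFn_le hd hb (measurableSet_toMeasurable _ _)
    (by rwa [measure_toMeasurable]) ?_).trans_eq ?_
  · intro h
    exact hG' (by rw [h, ENNReal.top_rpow_of_pos (by norm_num)])
  · rw [ENNReal.mul_rpow_of_nonneg _ _ (by norm_num), ← mul_assoc]
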